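/- Let $k$ be a field and let $\Delta$ be a finite simplicial complex with vertex set $V$: a collection of subsets of $V$ (the faces) that is closed under taking subsets and contains $\emptyset$ and $\{v\}$ for every $v\in V$. Assume that $\Delta$ is not the boundary of a simplex, i.e. that the faces of $\Delta$ are not exactly the proper subsets of $V$. Let $S=k[x_\sigma \mid \sigma\in\Delta]$ have one variable for each face of $\Delta$ (the empty face included), and let $$J'_\Delta=(m'_v \mid v\in V)\subseteq S,\qquad m'_v=\sqrt{\ \prod_{\substack{G \text{ facet of }\Delta\\ v\in G}}x_{G\setminus\{v\}}\ \prod_{\substack{F\text{ facet of }\Delta\\ v\notin F}}\Bigl(x_F\prod_{\substack{\sigma\subset F\\ |\sigma|=|F|-1}}x_\sigma\Bigr)}\,,$$ where the square root of a monomial denotes its squarefree part (the product of the variables dividing it) and a facet is a face that is maximal under inclusion. The Scarf complex of a monomial ideal $I$ is the simplicial complex whose vertices are the minimal monomial generators of $I$ and whose faces are the sets of minimal generators whose least common multiple differs from that of every other set of minimal generators (the empty set, with least common multiple $1$, is one of these sets). A complex $\Gamma$ whose vertices are labelled by monomials of $S$ minimally resolves $I$ if its chain complex over $S$, with one basis element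 $e_\sigma$ for each face $\sigma$ (including $\emptyset$) and differential $e_\sigma\mapsto\sum_{v\in\sigma}\pm\frac{\operatorname{lcm}(\sigma)}{\operatorname{lcm}(\sigma\setminus\{v\})}\,e_{\sigma\setminus\{v\}}$ with the usual simplicial signs, is a minimal free resolution of $S/I$. Here $\operatorname{lcm}(\sigma)$ is the least common multiple of the labels of the vertices of $\sigma$. A Scarf ideal is a monomial ideal minimally resolved by its Scarf complex, each vertex of which is labelled by itself. Then: (1) $\Delta$ is the Scarf complex of $J'_\Delta$: the map $v\mapsto m'_v$ is a bijection from $V$ onto the set of minimal monomial generators of $J'_\Delta$, and it identifies $\Delta$ with the Scarf complex of $J'_\Delta$. (2) If $\Delta$ is acyclic (all its reduced simplicial homology with coefficients in $k$ vanishes), and in particular if $\Delta$ is a simplicial tree (a connected complex such that every nonempty set $C$ of facets contains a leaf, i.e. a facet $F\in C$ such that either $C=\{F\}$ or there is $G\in C\setminus\{F\}$ with $F\cap H\subseteq G$ for all $H\in C\setminus\{F\}$), then $J'_\Delta$ is a Scarf ideal; that is, $\Delta$ with the vertex labels $m'_v$ minimally resolves $J'_\Delta$. -/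

import Mathlib

namespace Scarf

open MvPolynomial

/-! ### Faces and chain complexes

Mathlib's simplicial complexes list only their nonempty faces; here the empty face is added back. -/

/-- A face of `K`, the empty face included. -/
abbrev Face {W : Type*} (K : PreAbstractSimplicialComplex W) : Type _ :=
  {s : Finset W // s ∈ K.faces ∨ s = ∅}

open Classical in
/-- The face `s \ {v}`. -/
noncomputable def Face.erase {W : Type*} {K : PreAbstractSimplicialComplex W}
    (s : Face K) (v : W) : Face K :=
  ⟨s.1.erase v, by
    rcases Finset.eq_empty_or_nonempty (s.1.erase v) with h | h
    · exact Or.inr h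
    · rcases s.2 with hs | hs
      · exact Or.inl ((K.isRelLowerSet_faces hs).2 (Finset.erase_subset v s.1) h)
      · simp [hs] at h⟩

/-- The faces with exactly `i` vertices, that is, of dimension `i - 1`. -/
abbrev FaceOfCard {W : Type*} (K : PreAbstractSimplicialComplex W) (i : ℕ) : Type _ :=
  {s : Face K // s.1.card = i}

open Classical in
/-- The face `s \ {v}` for a vertex `v` of `s`, as a face with one vertex less. -/
noncomputable def FaceOfCard.erase {W : Type*} {K : PreAbstractSimplicialComplex W} {i : ℕ}
    (s : FaceOfCard K (i + 1)) (v : {v // v ∈ s.1.1}) : FaceOfCard K i :=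
  ⟨s.1.erase v.1, by
    have h := Finset.card_erase_of_mem v.2
    rw [s.2, Nat.add_sub_cancel] at h
    exact h⟩

open Classical in
/-- The boundary map of the augmented simplicial chain complex of `K` with coefficients twisted by
`c`, for the orientation given by a total order `r` of the vertices: it sends the basis element of
a face `s` to the sum, over its vertices `v`, of `± c s v` times the basis element of `s \ {v}`,
where the sign is `(-1) ^ p` if `v` is preceded by exactly `p` vertices of `s`. -/
noncomputable def boundary {W : Type*} (R : Type*) [CommRing R]
    (K : PreAbstractSimplicialComplex W) (r : W → W → Prop) (c : Finset W → W → R) (i : ℕ) :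
    (FaceOfCard K (i + 1) →₀ R) →ₗ[R] (FaceOfCard K i →₀ R) :=
  Finsupp.linearCombination R fun s : FaceOfCard K (i + 1) =>
    ∑ v : {v // v ∈ s.1.1},
      Finsupp.single (s.erase v) ((-1) ^ (s.1.1.filter fun w => r w v.1).card * c s.1.1 v.1)

/-- `K` is acyclic over `R`: its reduced simplicial homology with coefficients in `R` vanishes in
every degree, degree `-1` included. (The vanishing does not depend on the order `r`.) -/
def IsAcyclic {W : Type*} (R : Type*) [CommRing R] (K : PreAbstractSimplicialComplex W) : Prop :=
  ∀ r : W → W → Prop, IsStrictTotalOrder W r →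
    Function.Surjective (boundary R K r (fun _ _ => 1) 0) ∧
    ∀ i : ℕ, Function.Exact (boundary R K r (fun _ _ => 1) (i + 1))
      (boundary R K r (fun _ _ => 1) i)

/-! ### Monomial labels, resolutions supported on a complex, and Scarf ideals

A monomial is represented by its exponent vector in `ι →₀ ℕ`; divisibility of monomials is then
the order of exponent vectors and the least common multiple is the supremum. -/

/-- The exponent vector of the least common multiple of the labels of the vertices in `s`. -/
noncomputable def lcmLabel {W ι : Type*} (m : W → ι →₀ ℕ) (s : Finset W) : ι →₀ ℕ :=
  s.sup m

open Classical in
/-- The `i`-th differential of the chain complex `C(K; S)` of the labelled complex `K`, where `S` is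
the polynomial ring: the coefficient of `s \ {v}` in the image of `s` is, up to sign, the
monomial `lcm(s) / lcm(s \ {v})`. -/
noncomputable def labelledBoundary {W ι : Type*} (k : Type*) [Field k]
    (K : PreAbstractSimplicialComplex W) (m : W → ι →₀ ℕ) (r : W → W → Prop) (i : ℕ) :
    (FaceOfCard K (i + 1) →₀ MvPolynomial ι k) →ₗ[MvPolynomial ι k]
      (FaceOfCard K i →₀ MvPolynomial ι k) :=
  boundary (MvPolynomial ι k) K r
    (fun s v => monomial (lcmLabel m s - lcmLabel m (s.erase v)) 1) i

/-- The augmentation `C_0(K; S) = S → S / I`, which sends the basis element of the empty face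
to `1`. -/
noncomputable def augmentation {W S : Type*} [CommRing S]
    (K : PreAbstractSimplicialComplex W) (I : Ideal S) :
    (FaceOfCard K 0 →₀ S) →ₗ[S] (S ⧸ I) :=
  Finsupp.linearCombination S fun _ : FaceOfCard K 0 => (1 : S ⧸ I)

/-- The chain complex of `K`, labelled by `m`, is a minimal free resolution of `S / I`: the
augmented complex of free modules `⋯ → C_1 → C_0 → S / I → 0` is exact, and every differential
maps into the multiple of its target by the ideal generated by the variables. -/
def MinimallyResolves {W ι k : Type*} [Field k]
    (K : PreAbstractSimplicialComplex W) (m : W → ι →₀ ℕ) (I : Ideal (MvPolynomial ι k)) : Prop :=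
  ∀ r : W → W → Prop, IsStrictTotalOrder W r →
    Function.Surjective (augmentation K I) ∧
    Function.Exact (labelledBoundary k K m r 0) (augmentation K I) ∧
    (∀ i : ℕ, Function.Exact (labelledBoundary k K m r (i + 1)) (labelledBoundary k K m r i)) ∧
    ∀ i : ℕ, LinearMap.range (labelledBoundary k K m r i) ≤
      Ideal.span (Set.range (X : ι → MvPolynomial ι k)) •
        (⊤ : Submodule (MvPolynomial ι k) (FaceOfCard K i →₀ MvPolynomial ι k))

/-- The minimal monomial generators of a monomial ideal `I`: the monomials in `I` which are minimal
for divisibility. -/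
def minGens {ι k : Type*} [Field k] (I : Ideal (MvPolynomial ι k)) : Set (ι →₀ ℕ) :=
  {e | Minimal (fun e : ι →₀ ℕ => monomial e (1 : k) ∈ I) e}

/-- The Scarf complex of a monomial ideal `I`: its vertices are the minimal monomial generators of
`I`, and a set of these is a face if no other set (the empty set included) has the same least
common multiple. -/
def scarfComplex {ι k : Type*} [Field k] (I : Ideal (MvPolynomial ι k)) :
    PreAbstractSimplicialComplex (minGens I) where
  faces := {s | s.Nonempty ∧ ∀ t : Finset (minGens I),
    lcmLabel (fun g : minGens I => g.1) t = lcmLabel (fun g : minGens I => g.1) s → t = s}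
  isRelLowerSet_faces := by
    classical
    rintro s ⟨hs, huniq⟩
    refine ⟨hs, fun t hts ht => ⟨ht, fun u hu => ?_⟩⟩
    unfold lcmLabel at huniq hu
    have hus : u ⊆ s := by
      have h : s \ t ∪ u = s := by
        apply huniq
        rw [Finset.sup_union, hu, ← Finset.sup_union, Finset.sdiff_union_of_subset hts]
      intro w hw
      rw [← h]
      exact Finset.mem_union_right _ hw
    have key : ∀ a b : Finset (minGens I), a ⊆ s → b ⊆ s →
        (a.sup fun g : minGens I => g.1) = (b.sup fun g : minGens I => g.1) → a ⊆ b := by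
      intro a b ha hb hab w hw
      by_contra hwb
      have h : s.erase w = s := by
        apply huniq
        conv_rhs => rw [← Finset.insert_erase (ha hw), Finset.sup_insert]
        refine (sup_eq_right.mpr ?_).symm
        calc (w : ι →₀ ℕ) ≤ a.sup (fun g : minGens I => g.1) :=
              Finset.le_sup (f := fun g : minGens I => g.1) hw
          _ = b.sup (fun g : minGens I => g.1) := hab
          _ ≤ _ := Finset.sup_mono (Finset.subset_erase.mpr ⟨hb, hwb⟩)
      exact Finset.erase_eq_self.mp h (ha hw)
    exact Finset.Subset.antisymm (key u t hus hts hu) (key t u hts hus hu.symm)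

/-- `Δ` is the Scarf complex of `I` via the labelling `m`: the labelling is a bijection from the
vertices of `Δ` onto the minimal monomial generators of `I`, and it identifies the faces of `Δ` with
those of the Scarf complex of `I`. -/
def IsScarfComplexOf {V ι k : Type*} [Field k] (Δ : AbstractSimplicialComplex V)
    (m : V → ι →₀ ℕ) (I : Ideal (MvPolynomial ι k)) : Prop :=
  ∃ e : V ≃ minGens I, (∀ v : V, (e v : ι →₀ ℕ) = m v) ∧
    ∀ s : Finset V, s ∈ Δ.faces ↔ s.map e.toEmbedding ∈ (scarfComplex I).faces

/-- A Scarf ideal is a monomial ideal which is minimally resolved by its Scarf complex. -/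
def IsScarfIdeal {ι k : Type*} [Field k] (I : Ideal (MvPolynomial ι k)) : Prop :=
  MinimallyResolves (scarfComplex I) (fun g : minGens I => g.1) I

/-! ### Facets, boundaries of simplices, trees -/

/-- A facet is a maximal face. -/
def IsFacet {W : Type*} {K : PreAbstractSimplicialComplex W} (F : Face K) : Prop :=
  ∀ G : Face K, F.1 ⊆ G.1 → G = F

/-- `Δ` is the boundary of the simplex on its vertex set: its faces are exactly the proper subsets
of the vertex set. -/
def IsBoundaryOfSimplex {V : Type*} [Fintype V] (Δ : AbstractSimplicialComplex V) : Prop :=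
  ∀ s : Finset V, (s ∈ Δ.faces ∨ s = ∅) ↔ s ≠ Finset.univ

/-- The graph of vertices and edges of `Δ`. -/
def oneSkeleton {V : Type*} (Δ : AbstractSimplicialComplex V) : SimpleGraph V :=
  open Classical in SimpleGraph.fromRel fun u v => ({u, v} : Finset V) ∈ Δ.faces

open Classical in
/-- `F` is a leaf of the complex whose set of facets is `C`: either it is the only facet, or some
other facet `G` contains the intersections of `F` with all the other facets. -/
def IsLeaf {W : Type*} {K : PreAbstractSimplicialComplex W} (C : Set (Face K)) (F : Face K) :
    Prop :=
  F ∈ C ∧ (C = {F} ∨ ∃ G ∈ C, G ≠ F ∧ ∀ H ∈ C, H ≠ F → F.1 ∩ H.1 ⊆ G.1)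

/-- A simplicial tree: a connected simplicial complex such that the subcomplex generated by any
nonempty set of facets has a leaf. -/
def IsTree {V : Type*} (Δ : AbstractSimplicialComplex V) : Prop :=
  (oneSkeleton Δ).Connected ∧
    ∀ C : Set (Face Δ.toPreAbstractSimplicialComplex), C.Nonempty → (∀ F ∈ C, IsFacet F) →
      ∃ F, IsLeaf C F

/-! ### The ideal -/

/-- The variables are indexed by the faces of `Δ`. -/
abbrev Var {V : Type*} (Δ : AbstractSimplicialComplex V) : Type _ :=
  Face Δ.toPreAbstractSimplicialComplex

open Classical in
/-- The exponent vector of the product of the variables `x_{G \ {v}}` for the facets `G` containing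
`v`, and of `x_F * ∏ x_σ` for the facets `F` not containing `v`, where `σ` ranges over the subsets
of `F` with `|F| - 1` elements. -/
noncomputable def rawGenerator {V : Type*} [Fintype V] (Δ : AbstractSimplicialComplex V) (v : V) :
    Var Δ →₀ ℕ :=
  (∑ G : Var Δ with IsFacet G ∧ v ∈ G.1, Finsupp.single (G.erase v) 1) +
    ∑ F : Var Δ with IsFacet F ∧ v ∉ F.1,
      (Finsupp.single F 1 +
        ∑ σ : Var Δ with σ.1 ⊆ F.1 ∧ σ.1.card + 1 = F.1.card, Finsupp.single σ 1)

/-- The exponent vector of the generator `m'_v`, the radical (squarefree part) of the product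
above. -/
noncomputable def generator {V : Type*} [Fintype V] (Δ : AbstractSimplicialComplex V) (v : V) :
    Var Δ →₀ ℕ :=
  (rawGenerator Δ v).mapRange (fun a => min a 1) (by simp)

/-- The ideal `J'_Δ` generated by the monomials `m'_v`. -/
noncomputable def trimmedIdeal {V : Type*} [Fintype V] (k : Type*) [Field k]
    (Δ : AbstractSimplicialComplex V) : Ideal (MvPolynomial (Var Δ) k) :=
  Ideal.span (Set.range fun v : V => monomial (generator Δ v) (1 : k))

end Scarf

namespace Scarf

open MvPolynomial

/-! ### Chains as functions on finite sets -/

section Chains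

/-! Call a facet, or a facet with one vertex removed, a test face. After passing to squarefree
parts, $m'_v$ is the product of the $x_\tau$ over the test faces $\tau$ not containing $v$
(`generator_apply`), so $x_\tau$ divides $\operatorname{lcm}(s)$ exactly when $s\not\subseteq\tau$.

Every face is the intersection of the test faces containing it, so no other set of vertices has the
same lcm. A nonface lies in no test face, so all nonfaces share one lcm, the product of all the
$x_\tau$. A nonface can therefore be a Scarf face only if it is the only nonface; it is then $V$
itself and $\Delta$ is the boundary of a simplex (`mem_faces_iff_lcmLabel_unique`).

A labelled complex resolves its ideal as soon as, for every monomial $x^b$, the subcomplex of faces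
whose lcm divides $x^b$ has no homology over $k$, the empty face aside (`exact_labelledBoundary`).
Here that subcomplex is the simplex on the intersection of the test faces $\tau$ with $b_\tau=0$, or
all of $\Delta$ if there are none (`cyclesBound_lcmLabel_le`), so acyclicity of $\Delta$ suffices.
Trees are acyclic by removing leaves one at a time (`CyclesBound.of_leaf`).

Homology is computed with functions on all finite sets of vertices, so that every complex shares the
boundary operator `bdry` and only the supports vary. -/

open Classical in
/-- The sign of `v` in `insert v t`: the parity of the number of elements of `t` preceding `v`. -/
noncomputable def sgn {W : Type*} (r : W → W → Prop) (t : Finset W) (v : W) : ℤ :=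
  (-1) ^ (t.filter fun w => r w v).card

open Classical in
/-- The simplicial boundary of a function on finite sets, regarded as a chain. -/
noncomputable def bdry {W M : Type*} [Fintype W] [AddCommGroup M] (r : W → W → Prop)
    (f : Finset W → M) (t : Finset W) : M :=
  ∑ v ∈ tᶜ, sgn r t v • f (insert v t)

open Classical in
/-- The cone homotopy with apex `a`. -/
noncomputable def cone {W M : Type*} [AddCommGroup M] (r : W → W → Prop) (a : W)
    (f : Finset W → M) (s : Finset W) : M :=
  if a ∈ s then sgn r (s.erase a) a • f (s.erase a) else 0

variable {W M : Type*} (r : W → W → Prop)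

lemma sgn_mul_self (t : Finset W) (v : W) : sgn r t v * sgn r t v = 1 := by
  rw [sgn, ← mul_pow]; simp

open Classical in
lemma sgn_insert {t : Finset W} {v : W} (hv : v ∉ t) (w : W) :
    sgn r (insert v t) w = (if r v w then -1 else 1) * sgn r t w := by
  unfold sgn
  rw [Finset.filter_insert]
  split_ifs with h
  · rw [Finset.card_insert_of_notMem (by simp [hv]), pow_succ]; ring
  · simp

open Classical in
-- Exactly one of $v$, $w$ precedes the other, so exactly one of the two insertions flips a sign.
lemma sgn_swap [IsStrictTotalOrder W r] {t : Finset W} {v w : W} (hv : v ∉ t) (hw : w ∉ t)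
    (hvw : v ≠ w) :
    sgn r t v * sgn r (insert v t) w = -(sgn r t w * sgn r (insert w t) v) := by
  rw [sgn_insert r hv, sgn_insert r hw]
  rcases trichotomous_of r v w with h | h | h
  · rw [if_pos h, if_neg (asymm_of r h)]; ring
  · exact absurd h hvw
  · rw [if_pos h, if_neg (asymm_of r h)]; ring

lemma bdry_map {N : Type*} [Fintype W] [AddCommGroup M] [AddCommGroup N] (φ : M →+ N)
    (f : Finset W → M) : bdry r (fun s => φ (f s)) = fun t => φ (bdry r f t) := by
  funext t
  simp [bdry, map_sum, map_zsmul]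

variable [Fintype W] [AddCommGroup M]

lemma bdry_add (f g : Finset W → M) : bdry r (f + g) = bdry r f + bdry r g := by
  funext t
  simp [bdry, Finset.sum_add_distrib]

lemma bdry_neg (f : Finset W → M) : bdry r (-f) = -bdry r f := by
  funext t
  simp [bdry]

lemma bdry_sub (f g : Finset W → M) : bdry r (f - g) = bdry r f - bdry r g := by
  rw [sub_eq_add_neg, bdry_add, bdry_neg, sub_eq_add_neg]

lemma bdry_zero : bdry r (0 : Finset W → M) = 0 := by
  funext t
  simp [bdry]

lemma bdry_sum {α : Type*} (B : Finset α) (f : α → Finset W → M) :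
    bdry r (∑ b ∈ B, f b) = ∑ b ∈ B, bdry r (f b) := by
  classical
  induction B using Finset.induction_on with
  | empty => simp [bdry_zero]
  | insert a B ha ih => rw [Finset.sum_insert ha, Finset.sum_insert ha, bdry_add, ih]

/-- Inserting $v$ then $w$ cancels against inserting $w$ then $v$, by `sgn_swap`. -/
theorem bdry_bdry [IsStrictTotalOrder W r] (f : Finset W → M) : bdry r (bdry r f) = 0 := by
  classical
  funext t
  simp only [bdry, Finset.smul_sum, smul_smul, Pi.zero_apply]
  rw [Finset.sum_sigma']
  refine Finset.sum_involution (fun p _ => ⟨p.2, p.1⟩) ?_ ?_ ?_ ?_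
  · rintro ⟨v, w⟩ h
    simp only [Finset.mem_sigma, Finset.mem_compl, Finset.mem_insert, not_or] at h
    rw [sgn_swap r h.1 h.2.2 (Ne.symm h.2.1), Finset.insert_comm, neg_smul, neg_add_cancel]
  · rintro ⟨v, w⟩ h _ he
    simp only [Finset.mem_sigma, Finset.mem_compl, Finset.mem_insert, not_or] at h
    simp only [Sigma.mk.injEq, heq_eq_eq] at he
    exact h.2.1 he.1
  · rintro ⟨v, w⟩ h
    simp only [Finset.mem_sigma, Finset.mem_compl, Finset.mem_insert, not_or] at h ⊢
    exact ⟨h.2.2, Ne.symm h.2.1, h.1⟩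
  · rintro ⟨v, w⟩ h
    rfl

/-- If $a\in t$, the term of $\partial f$ that inserts $a$ gives back $f(t)$ and the others cancel
by `sgn_swap`; if $a\notin t$, only the insertion of $a$ survives. -/
theorem bdry_cone_add [IsStrictTotalOrder W r] (a : W) (f : Finset W → M) :
    bdry r (cone r a f) + cone r a (bdry r f) = f := by
  classical
  funext t
  rw [Pi.add_apply]
  by_cases ha : a ∈ t
  · obtain ⟨u, hu, rfl⟩ : ∃ u, a ∉ u ∧ insert a u = t :=
      ⟨t.erase a, Finset.notMem_erase a t, Finset.insert_erase ha⟩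
    have h1 : cone r a (bdry r f) (insert a u) =
        f (insert a u) + ∑ v ∈ (insert a u)ᶜ, (sgn r u a * sgn r u v) • f (insert v u) := by
      rw [cone, if_pos ha, Finset.erase_insert hu, bdry]
      have : uᶜ = insert a (insert a u)ᶜ := by
        ext x
        by_cases hx : x = a <;> simp [hx, hu]
      rw [this, Finset.sum_insert (by simp), smul_add, smul_smul, sgn_mul_self, one_smul,
        Finset.smul_sum]
      simp only [smul_smul]
    rw [h1, add_left_comm, bdry, ← Finset.sum_add_distrib, Finset.sum_eq_zero, add_zero]
    intro v hv
    simp only [Finset.mem_compl, Finset.mem_insert, not_or] at hv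
    have h2 : (insert v (insert a u)).erase a = insert v u := by
      rw [Finset.insert_comm, Finset.erase_insert]
      simp [hu, Ne.symm hv.1]
    rw [cone, if_pos (by simp), h2, smul_smul, ← add_smul]
    have h3 := sgn_swap r hu hv.2 (Ne.symm hv.1)
    have h4 := sgn_mul_self r u a
    have h5 := sgn_mul_self r u v
    have : sgn r (insert a u) v * sgn r (insert v u) a = -(sgn r u a * sgn r u v) := by
      calc _ = (sgn r u a * sgn r u a) * (sgn r (insert a u) v * sgn r (insert v u) a) := by
              rw [h4, one_mul]
        _ = sgn r u a * (sgn r u a * sgn r (insert a u) v) * sgn r (insert v u) a := by ring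
        _ = -(sgn r u a * sgn r u v) * (sgn r (insert v u) a * sgn r (insert v u) a) := by
              rw [h3]; ring
        _ = _ := by rw [sgn_mul_self, mul_one]
    rw [this, neg_add_cancel, zero_smul]
  · rw [cone, if_neg ha, add_zero, bdry, Finset.sum_eq_single a]
    · rw [cone, if_pos (Finset.mem_insert_self _ _), Finset.erase_insert ha, smul_smul,
        sgn_mul_self, one_smul]
    · intro v _ hva
      rw [cone, if_neg (by simp [ha, Ne.symm hva]), smul_zero]
    · simp [ha]

end Chains

/-- Every cycle with values in `M`, supported on sets of size `j` satisfying `P`, is the boundary of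
a chain supported on sets of size `j + 1` satisfying `P`. -/
def CyclesBound {W : Type*} [Fintype W] (M : Type*) [AddCommGroup M] (r : W → W → Prop)
    (P : Finset W → Prop) (j : ℕ) : Prop :=
  ∀ f : Finset W → M, (∀ s, f s ≠ 0 → P s ∧ s.card = j) → bdry r f = 0 →
    ∃ g : Finset W → M, (∀ s, g s ≠ 0 → P s ∧ s.card = j + 1) ∧ bdry r g = f

/-- Coning from a vertex of $T$ stays inside $T$. If $T$ is empty, only the empty set can carry a
chain, and $1\le j$ excludes it. -/
theorem cyclesBound_simplex {W M : Type*} [Fintype W] [AddCommGroup M] (r : W → W → Prop)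
    [IsStrictTotalOrder W r] (T : Finset W) (j : ℕ) (h : T.Nonempty ∨ 1 ≤ j) :
    CyclesBound M r (· ⊆ T) j := by
  classical
  intro f hf hd
  rcases T.eq_empty_or_nonempty with rfl | ⟨a, ha⟩
  · have hj : 1 ≤ j := by simpa using h
    refine ⟨0, by simp, ?_⟩
    rw [bdry_zero]
    funext s
    by_contra hs
    obtain ⟨h1, h2⟩ := hf s (Ne.symm hs)
    rw [Finset.subset_empty.mp h1] at h2
    simp at h2
    omega
  · refine ⟨cone r a f, fun s hs => ?_, ?_⟩
    · rw [cone] at hs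
      split_ifs at hs with has
      · obtain ⟨h1, h2⟩ := hf _ (fun h0 => hs (by rw [h0, smul_zero]))
        refine ⟨fun x hx => ?_, ?_⟩
        · by_cases hxa : x = a
          · rw [hxa]; exact ha
          · exact h1 (Finset.mem_erase.mpr ⟨hxa, hx⟩)
        · rw [← h2, Finset.card_erase_add_one has]
      · exact absurd rfl hs
    · have := bdry_cone_add r a f
      rw [hd] at this
      have h0 : cone r a (0 : Finset W → M) = 0 := by
        funext s; simp [cone]
      rwa [h0, add_zero] at this

lemma bdry_comp_map {V W M : Type*} [Fintype V] [Fintype W] [AddCommGroup M] (e : V ≃ W)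
    (r : W → W → Prop) (f : Finset W → M) (t : Finset V) :
    bdry (fun a b => r (e a) (e b)) (fun s => f (s.map e.toEmbedding)) t =
      bdry r f (t.map e.toEmbedding) := by
  classical
  unfold bdry
  refine Finset.sum_equiv e (by simp) fun v _ => ?_
  simp only [Finset.map_insert]
  congr 1
  unfold sgn
  congr 1
  rw [Finset.filter_map, Finset.card_map]
  rfl

/-- The order is pulled back along $e$, so the signs on both sides agree. -/
theorem CyclesBound.map_equiv {V W M : Type*} [Fintype V] [Fintype W] [AddCommGroup M] (e : V ≃ W)
    {r : W → W → Prop} {P : Finset W → Prop} {j : ℕ}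
    (h : CyclesBound M (fun a b => r (e a) (e b)) (fun s => P (s.map e.toEmbedding)) j) :
    CyclesBound M r P j := by
  classical
  intro f hf hd
  obtain ⟨g, hg, hgf⟩ := h (fun s => f (s.map e.toEmbedding))
    (fun s hs => by simpa using hf _ hs) (by
      funext t
      rw [bdry_comp_map, hd]; rfl)
  have hs : ∀ s : Finset W, (s.map e.symm.toEmbedding).map e.toEmbedding = s := fun s => by
    ext x; simp
  have hs' : ∀ s : Finset V, (s.map e.toEmbedding).map e.symm.toEmbedding = s := fun s => by
    ext x; simp
  refine ⟨fun s => g (s.map e.symm.toEmbedding), fun s hne => ?_, ?_⟩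
  · simpa [hs] using hg _ hne
  · funext t
    have h1 := bdry_comp_map e r (fun s => g (s.map e.symm.toEmbedding)) (t.map e.symm.toEmbedding)
    simp only [hs, hs'] at h1
    rw [← h1, hgf]
    simp only [hs]

/-! ### Comparison with the chain complexes of a complex -/

section Comparison

variable {W : Type*} {R : Type*} [CommRing R] {K : PreAbstractSimplicialComplex W}

open Classical in
/-- Extension by zero of a chain of `K` to a function on all finite sets. -/
noncomputable def toChain {i : ℕ} : (FaceOfCard K i →₀ R) →ₗ[R] (Finset W → R) where
  toFun f s := if h : (s ∈ K.faces ∨ s = ∅) ∧ s.card = i then f ⟨⟨s, h.1⟩, h.2⟩ else 0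
  map_add' f g := by
    funext s
    by_cases h : (s ∈ K.faces ∨ s = ∅) ∧ s.card = i <;> simp [h]
  map_smul' a f := by
    funext s
    by_cases h : (s ∈ K.faces ∨ s = ∅) ∧ s.card = i <;> simp [h]

lemma toChain_apply_face {i : ℕ} (f : FaceOfCard K i →₀ R) (s : FaceOfCard K i) :
    toChain f s.1.1 = f s := by
  have h : (s.1.1 ∈ K.faces ∨ s.1.1 = ∅) ∧ s.1.1.card = i := ⟨s.1.2, s.2⟩
  simp only [toChain, LinearMap.coe_mk, AddHom.coe_mk]
  rw [dif_pos h]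

lemma toChain_support {i : ℕ} (f : FaceOfCard K i →₀ R) (s : Finset W) (hs : toChain f s ≠ 0) :
    (s ∈ K.faces ∨ s = ∅) ∧ s.card = i := by
  by_contra h
  refine hs ?_
  simp only [toChain, LinearMap.coe_mk, AddHom.coe_mk]
  rw [dif_neg h]

lemma toChain_injective {i : ℕ} :
    Function.Injective (toChain : (FaceOfCard K i →₀ R) →ₗ[R] (Finset W → R)) := by
  intro f g h
  ext s
  rw [← toChain_apply_face, h, toChain_apply_face]

open Classical in
lemma toChain_single {i : ℕ} (s : FaceOfCard K i) (a : R) (t : Finset W) :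
    toChain (Finsupp.single s a) t = if s.1.1 = t then a else 0 := by
  split_ifs with h
  · rw [← h, toChain_apply_face, Finsupp.single_eq_same]
  · by_contra h0
    have h1 := toChain_support _ _ h0
    have h2 := toChain_apply_face (Finsupp.single s a) ⟨⟨t, h1.1⟩, h1.2⟩
    rw [Finsupp.single_eq_of_ne] at h2
    · exact h0 h2
    · rintro rfl
      exact h rfl

variable [Fintype W]

lemma exists_toChain_eq {i : ℕ} (g : Finset W → R)
    (hg : ∀ s, g s ≠ 0 → (s ∈ K.faces ∨ s = ∅) ∧ s.card = i) :
    ∃ f : FaceOfCard K i →₀ R, toChain f = g := by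
  classical
  refine ⟨Finsupp.equivFunOnFinite.symm fun s => g s.1.1, ?_⟩
  funext s
  by_cases h : (s ∈ K.faces ∨ s = ∅) ∧ s.card = i
  · exact toChain_apply_face _ ⟨⟨s, h.1⟩, h.2⟩
  · rw [not_imp_comm.mp (hg s) h]
    exact not_imp_comm.mp (toChain_support _ s) h

open Classical in
theorem toChain_boundary (r : W → W → Prop) [IsStrictTotalOrder W r] (c : Finset W → W → R) (i : ℕ)
    (f : FaceOfCard K (i + 1) →₀ R) (t : Finset W) :
    toChain (boundary R K r c i f) t =
      ∑ v ∈ tᶜ, sgn r t v • (c (insert v t) v * toChain f (insert v t)) := by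
  induction f using Finsupp.induction_linear with
  | zero => simp
  | add f g hf hg =>
    rw [map_add, map_add, Pi.add_apply, hf, hg, ← Finset.sum_add_distrib]
    refine Finset.sum_congr rfl fun v _ => ?_
    rw [map_add, Pi.add_apply, mul_add, smul_add]
  | single s a =>
    rw [boundary, Finsupp.linearCombination_single, map_smul, map_sum, Pi.smul_apply,
      Finset.sum_apply, smul_eq_mul]
    simp only [toChain_single]
    have h1 := Finset.sum_coe_sort s.1.1 (fun v => if s.1.1.erase v = t then
      ((-1 : R) ^ (s.1.1.filter fun w => r w v).card * c s.1.1 v) else 0)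
    have h2 : ∀ v : {v // v ∈ s.1.1}, (s.erase v).1.1 = s.1.1.erase v := fun _ => rfl
    simp only [h2]
    rw [h1]
    simp only [mul_ite, mul_zero, smul_ite, smul_zero]
    rw [← Finset.sum_filter, ← Finset.sum_filter, Finset.mul_sum]
    -- The boundary sums over vertices deleted from $s$, the right-hand side over vertices inserted
    -- into $t$; both describe the pairs with $s=t\cup\{v\}$.
    have h3 : s.1.1.filter (fun v => s.1.1.erase v = t) =
        (tᶜ).filter (fun v => s.1.1 = insert v t) := by
      ext v
      simp only [Finset.mem_filter, Finset.mem_compl]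
      constructor
      · rintro ⟨h, rfl⟩
        exact ⟨Finset.notMem_erase _ _, (Finset.insert_erase h).symm⟩
      · rintro ⟨h, h'⟩
        rw [h']
        exact ⟨Finset.mem_insert_self _ _, Finset.erase_insert h⟩
    rw [h3]
    refine Finset.sum_congr rfl fun v hv => ?_
    obtain ⟨hv, hs⟩ := Finset.mem_filter.mp hv
    rw [← hs, sgn, zsmul_eq_mul]
    have h4 : s.1.1.filter (fun w => r w v) = t.filter (fun w => r w v) := by
      rw [hs, Finset.filter_insert, if_neg (irrefl_of r v)]
    rw [h4]
    push_cast
    ring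

lemma toChain_boundary_one (r : W → W → Prop) [IsStrictTotalOrder W r] (i : ℕ)
    (f : FaceOfCard K (i + 1) →₀ R) :
    toChain (boundary R K r (fun _ _ => 1) i f) = bdry r (toChain f) := by
  funext t
  rw [toChain_boundary, bdry]
  simp only [one_mul]

/-- Here $j$ counts vertices. For $j=0$ every chain is a cycle, so the condition becomes
surjectivity of the last boundary map. -/
theorem isAcyclic_iff : IsAcyclic R K ↔ ∀ r : W → W → Prop, IsStrictTotalOrder W r →
    ∀ j, CyclesBound R r (fun s => s ∈ K.faces ∨ s = ∅) j := by
  constructor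
  · intro h r hr j f hf hd
    obtain ⟨f, rfl⟩ := exists_toChain_eq f hf
    obtain ⟨h0, h1⟩ := h r hr
    obtain ⟨g, rfl⟩ : ∃ g, boundary R K r (fun _ _ => 1) j g = f := by
      cases j with
      | zero => exact h0 f
      | succ j =>
        refine (h1 j f).mp (toChain_injective ?_)
        rw [toChain_boundary_one, hd, map_zero]
    exact ⟨toChain g, toChain_support g, (toChain_boundary_one r j g).symm⟩
  · intro h r hr
    have key : ∀ j (f : FaceOfCard K j →₀ R), bdry r (toChain f) = 0 →
        ∃ g, boundary R K r (fun _ _ => 1) j g = f := by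
      intro j f hd
      obtain ⟨g, hg, hgf⟩ := h r hr j (toChain f) (toChain_support f) hd
      obtain ⟨g, rfl⟩ := exists_toChain_eq g hg
      exact ⟨g, toChain_injective (by rw [toChain_boundary_one, hgf])⟩
    refine ⟨fun f => key 0 f ?_, fun i f => ⟨fun hf => key _ f ?_, ?_⟩⟩
    · classical
      funext t
      refine Finset.sum_eq_zero fun v hv => ?_
      rw [not_imp_comm.mp (toChain_support f _) (by simp), smul_zero]
    · rw [← toChain_boundary_one, hf, map_zero]
    · rintro ⟨g, rfl⟩
      refine toChain_injective ?_
      rw [toChain_boundary_one, toChain_boundary_one, bdry_bdry, map_zero]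

end Comparison

/-! ### Resolutions supported on a labelled complex -/

section Labelled

variable {W ι k : Type*} [Field k] {K : PreAbstractSimplicialComplex W}

/-- A chain of a labelled complex, with the coefficient of each face multiplied by its label. -/
noncomputable def homogenize (m : W → ι →₀ ℕ) {i : ℕ} (f : FaceOfCard K i →₀ MvPolynomial ι k)
    (s : Finset W) : MvPolynomial ι k :=
  monomial (lcmLabel m s) 1 * toChain f s

lemma monomial_one_mul_injective (e : ι →₀ ℕ) :
    Function.Injective fun p : MvPolynomial ι k => monomial e 1 * p := by
  intro p q h
  have he : monomial e (1 : k) ≠ 0 := monomial_eq_zero.not.mpr one_ne_zero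
  exact mul_left_cancel₀ he h

lemma homogenize_injective (m : W → ι →₀ ℕ) {i : ℕ} :
    Function.Injective (homogenize m :
      (FaceOfCard K i →₀ MvPolynomial ι k) → Finset W → MvPolynomial ι k) := by
  intro f g h
  refine toChain_injective (funext fun s => ?_)
  have hs : homogenize m f s = homogenize m g s := congrFun h s
  exact monomial_one_mul_injective (lcmLabel m s) hs

lemma augmentation_apply (I : Ideal (MvPolynomial ι k)) (f : FaceOfCard K 0 →₀ MvPolynomial ι k) :
    augmentation K I f = Ideal.Quotient.mk I (toChain f ∅) := by
  induction f using Finsupp.induction_linear with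
  | zero => simp
  | add f g hf hg => rw [map_add, hf, hg, map_add, Pi.add_apply, map_add]
  | single s a =>
    classical
    rw [augmentation, Finsupp.linearCombination_single, toChain_single,
      if_pos (Finset.card_eq_zero.mp s.2)]
    exact (Algebra.algebraMap_eq_smul_one a).symm

variable [Fintype W]

/-- Since
$\operatorname{lcm}(t)\cdot\operatorname{lcm}(s)/\operatorname{lcm}(t)=\operatorname{lcm}(s)$,
multiplying by the labels turns the differential into the untwisted simplicial boundary. -/
lemma homogenize_labelledBoundary (m : W → ι →₀ ℕ) (r : W → W → Prop) [IsStrictTotalOrder W r]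
    (i : ℕ) (f : FaceOfCard K (i + 1) →₀ MvPolynomial ι k) :
    homogenize m (labelledBoundary k K m r i f) = bdry r (homogenize m f) := by
  classical
  funext t
  rw [homogenize, labelledBoundary, toChain_boundary, bdry, Finset.mul_sum]
  refine Finset.sum_congr rfl fun v hv => ?_
  have hle : lcmLabel m t ≤ lcmLabel m (insert v t) := Finset.sup_mono (Finset.subset_insert v t)
  have he : lcmLabel m t + (lcmLabel m (insert v t) - lcmLabel m ((insert v t).erase v)) =
      lcmLabel m (insert v t) := by
    rw [Finset.erase_insert (Finset.mem_compl.mp hv), add_tsub_cancel_of_le hle]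
  rw [mul_smul_comm, ← mul_assoc, homogenize, monomial_mul, mul_one]
  congr 4

/-- The coefficient of $x^b$ in a homogenized cycle is a cycle over $k$ supported on the faces whose
label divides $x^b$. It is filled there for each $b$, and the fillings are reassembled. -/
theorem exact_labelledBoundary (m : W → ι →₀ ℕ) (r : W → W → Prop) [IsStrictTotalOrder W r] (i : ℕ)
    (h : ∀ b : ι →₀ ℕ,
      CyclesBound k r (fun s => (s ∈ K.faces ∨ s = ∅) ∧ lcmLabel m s ≤ b) (i + 1)) :
    Function.Exact (labelledBoundary k K m r (i + 1)) (labelledBoundary k K m r i) := by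
  classical
  intro f
  constructor
  · intro hf
    have hd : bdry r (homogenize m f) = 0 := by
      rw [← homogenize_labelledBoundary, hf]
      funext s
      simp [homogenize]
    have hw : ∀ b : ι →₀ ℕ, ∃ g : Finset W → k,
        (∀ s, g s ≠ 0 → ((s ∈ K.faces ∨ s = ∅) ∧ lcmLabel m s ≤ b) ∧ s.card = i + 2) ∧
        bdry r g = fun s => coeff b (homogenize m f s) := by
      intro b
      refine h b _ (fun s hs => ?_) ?_
      · rw [homogenize, coeff_monomial_mul'] at hs
        split_ifs at hs with hle
        · have := toChain_support f s (fun h0 => hs (by rw [h0, coeff_zero, mul_zero]))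
          exact ⟨⟨this.1, hle⟩, this.2⟩
        · exact absurd rfl hs
      · have := bdry_map r (coeffAddMonoidHom b) (homogenize m f)
        simp only [coeffAddMonoidHom_apply] at this
        rw [this, hd]
        funext s
        simp
    choose w hw hwd using hw
    -- Only the finitely many exponents occurring in $f$ matter.
    set B : Finset (ι →₀ ℕ) := Finset.univ.biUnion fun s => (homogenize m f s).support
    obtain ⟨g, hg⟩ : ∃ g : FaceOfCard K (i + 2) →₀ MvPolynomial ι k,
        toChain g = fun s => ∑ b ∈ B, monomial (b - lcmLabel m s) (w b s) := by
      refine exists_toChain_eq _ fun s hs => ?_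
      obtain ⟨b, -, hb⟩ := Finset.exists_ne_zero_of_sum_ne_zero hs
      have := hw b s (fun h0 => hb (by rw [h0, monomial_zero]))
      exact ⟨this.1.1, this.2⟩
    have hg' : homogenize m g = ∑ b ∈ B, fun s => monomial b (w b s) := by
      funext s
      rw [homogenize, hg, Finset.mul_sum, Finset.sum_apply]
      refine Finset.sum_congr rfl fun b _ => ?_
      -- The truncated subtraction is a true one wherever `w b s` is nonzero, because there the
      -- label of $s$ is at most $b$.
      by_cases h0 : w b s = 0
      · simp [h0]
      · rw [monomial_mul, one_mul, add_tsub_cancel_of_le (hw b s h0).1.2]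
    refine ⟨g, homogenize_injective m ?_⟩
    rw [homogenize_labelledBoundary, hg', bdry_sum]
    funext s
    rw [Finset.sum_apply]
    have hb : ∀ b, bdry r (fun s => monomial b (w b s)) s =
        monomial b (coeff b (homogenize m f s)) := by
      intro b
      have := bdry_map r ((monomial b : k →ₗ[k] MvPolynomial ι k).toAddMonoidHom) (w b)
      simp only [LinearMap.toAddMonoidHom_coe] at this
      rw [this, hwd]
    simp only [hb]
    conv_rhs => rw [(homogenize m f s).as_sum]
    refine (Finset.sum_subset (Finset.subset_biUnion_of_mem
      (fun s => (homogenize m f s).support) (Finset.mem_univ s)) fun b _ hb => ?_).symm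
    rw [notMem_support_iff.mp hb, monomial_zero]
  · rintro ⟨g, rfl⟩
    refine homogenize_injective m ?_
    rw [homogenize_labelledBoundary, homogenize_labelledBoundary, bdry_bdry]
    funext s
    simp [homogenize]

/-- The image of the first differential is the ideal spanned by the vertex labels, so no acyclicity
is needed at this spot. -/
theorem exact_augmentation (m : W → ι →₀ ℕ) (r : W → W → Prop) [IsStrictTotalOrder W r]
    (hK : ∀ v, {v} ∈ K.faces) :
    Function.Exact (labelledBoundary k K m r 0)
      (augmentation K (Ideal.span (Set.range fun v => monomial (m v) (1 : k)))) := by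
  classical
  have hb : ∀ g : FaceOfCard K 1 →₀ MvPolynomial ι k,
      toChain (labelledBoundary k K m r 0 g) ∅ = ∑ v, toChain g {v} * monomial (m v) 1 := by
    intro g
    have h := congrFun (homogenize_labelledBoundary m r 0 g) ∅
    rw [homogenize, lcmLabel, Finset.sup_empty] at h
    simp only [bot_eq_zero, monomial_zero', C_1, one_mul] at h
    rw [h, bdry, Finset.compl_empty]
    refine Finset.sum_congr rfl fun v _ => ?_
    simp [sgn, homogenize, lcmLabel, mul_comm]
  intro f
  rw [augmentation_apply, Ideal.Quotient.eq_zero_iff_mem, Ideal.mem_span_range_iff_exists_fun]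
  constructor
  · rintro ⟨c, hc⟩
    obtain ⟨g, hg⟩ : ∃ g : FaceOfCard K 1 →₀ MvPolynomial ι k,
        toChain g = fun s => ∑ v, if s = {v} then c v else 0 := by
      refine exists_toChain_eq _ fun s hs => ?_
      obtain ⟨v, -, hv⟩ := Finset.exists_ne_zero_of_sum_ne_zero hs
      split_ifs at hv with h
      · rw [h]; exact ⟨Or.inl (hK v), Finset.card_singleton v⟩
      · exact absurd rfl hv
    refine ⟨g, toChain_injective (funext fun s => ?_)⟩
    by_cases hs : s = ∅
    · rw [hs, hb, hg, ← hc]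
      simp
    · have hs' : ¬((s ∈ K.faces ∨ s = ∅) ∧ s.card = 0) := fun h => hs (Finset.card_eq_zero.mp h.2)
      rw [not_imp_comm.mp (toChain_support _ s) hs', not_imp_comm.mp (toChain_support f s) hs']
  · rintro ⟨g, rfl⟩
    exact ⟨fun v => toChain g {v}, (hb g).symm⟩

lemma monomial_mem_span_X {e : ι →₀ ℕ} (he : e ≠ 0) :
    monomial e (1 : k) ∈ Ideal.span (Set.range (X : ι → MvPolynomial ι k)) := by
  obtain ⟨i, hi⟩ := Finsupp.ne_iff.mp he
  rw [Finsupp.zero_apply] at hi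
  have hle : Finsupp.single i 1 ≤ e := Finsupp.single_le_iff.mpr (Nat.one_le_iff_ne_zero.mpr hi)
  have h : monomial e (1 : k) = monomial (e - Finsupp.single i 1) 1 * X i := by
    rw [X, monomial_mul, one_mul, tsub_add_cancel_of_le hle]
  rw [h]
  exact Ideal.mul_mem_left _ _ (Ideal.subset_span ⟨i, rfl⟩)

open Classical in
-- `hm` makes the labels grow strictly along faces, so no matrix entry is a unit. The case $j=0$ is
-- not required because `exact_augmentation` covers it.
theorem minimallyResolves_of_cyclesBound (m : W → ι →₀ ℕ) (hK : ∀ v, {v} ∈ K.faces)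
    (hm : ∀ s ∈ K.faces, ∀ t ⊂ s, ¬lcmLabel m s ≤ lcmLabel m t)
    (h : ∀ r : W → W → Prop, IsStrictTotalOrder W r → ∀ (b : ι →₀ ℕ) (j : ℕ), 1 ≤ j →
      CyclesBound k r (fun s => (s ∈ K.faces ∨ s = ∅) ∧ lcmLabel m s ≤ b) j) :
    MinimallyResolves K m (Ideal.span (Set.range fun v => monomial (m v) (1 : k))) := by
  intro r hr
  refine ⟨fun q => ?_, exact_augmentation m r hK,
    fun i => exact_labelledBoundary m r i fun b => h r hr b _ (by omega), fun i => ?_⟩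
  · obtain ⟨p, rfl⟩ := Ideal.Quotient.mk_surjective q
    refine ⟨Finsupp.single ⟨⟨∅, Or.inr rfl⟩, rfl⟩ p, ?_⟩
    rw [augmentation_apply, toChain_single, if_pos rfl]
  · rw [labelledBoundary, boundary, Finsupp.range_linearCombination, Submodule.span_le]
    rintro _ ⟨s, rfl⟩
    refine Submodule.sum_mem _ fun v _ => ?_
    rw [← mul_one ((-1) ^ _ * _), ← smul_eq_mul, ← Finsupp.smul_single]
    refine Submodule.smul_mem_smul (Ideal.mul_mem_left _ _ (monomial_mem_span_X ?_)) trivial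
    intro h0
    have hs : s.1.1 ∈ K.faces := s.1.2.resolve_right (fun h => by simpa [h] using v.2)
    exact hm _ hs _ (Finset.erase_ssubset v.2) (tsub_eq_zero_iff_le.mp h0)

end Labelled

/-! ### Simplicial trees are acyclic -/

section Tree

variable {V M : Type*} [AddCommGroup M] (r : V → V → Prop)

open Classical in
/-- The chain with coefficient `a` at the vertex `v`. -/
noncomputable def vertexChain (v : V) (a : M) (s : Finset V) : M := if s = {v} then a else 0

lemma vertexChain_sub_support (u v : V) (a : M) (s : Finset V)
    (hs : (vertexChain u a - vertexChain v a) s ≠ 0) : (s = {u} ∨ s = {v}) ∧ s.card = 1 := by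
  rw [Pi.sub_apply, vertexChain, vertexChain] at hs
  split_ifs at hs with h1 h2 h2 <;> simp_all

variable [Fintype V]

lemma bdry_support {j : ℕ} {P : Finset V → Prop} (hP : ∀ s t, s ⊆ t → P t → P s)
    {f : Finset V → M} (hf : ∀ s, f s ≠ 0 → P s ∧ s.card = j + 1) (s : Finset V)
    (hs : bdry r f s ≠ 0) : P s ∧ s.card = j := by
  classical
  obtain ⟨v, hv, h⟩ := Finset.exists_ne_zero_of_sum_ne_zero hs
  obtain ⟨h1, h2⟩ := hf _ (fun h0 => h (by rw [h0, smul_zero]))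
  refine ⟨hP _ _ (Finset.subset_insert v s) h1, ?_⟩
  rw [Finset.card_insert_of_notMem (Finset.mem_compl.mp hv)] at h2
  omega

open Classical in
lemma bdry_vertexChain (v : V) (a : M) :
    bdry r (vertexChain v a) = fun t => if t = ∅ then a else 0 := by
  funext t
  have h1 : ∀ u ∈ tᶜ, (insert u t = {v} ↔ u = v ∧ t = ∅) := by
    intro u hu
    constructor
    · intro h
      have huv : u = v := Finset.mem_singleton.mp (h ▸ Finset.mem_insert_self u t)
      refine ⟨huv, Finset.eq_empty_of_forall_notMem fun x hx => ?_⟩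
      have : x = v := Finset.mem_singleton.mp (h ▸ Finset.mem_insert_of_mem hx)
      exact Finset.mem_compl.mp hu (by rwa [huv, ← this])
    · rintro ⟨rfl, rfl⟩
      simp
  rw [bdry, Finset.sum_congr rfl fun u hu => by rw [vertexChain, if_congr (h1 u hu) rfl rfl]]
  split_ifs with ht
  · subst ht
    simp [sgn]
  · simp [ht]

lemma bdry_vertexChain_sub (u v : V) (a : M) :
    bdry r (vertexChain u a - vertexChain v a) = 0 := by
  rw [bdry_sub, bdry_vertexChain, bdry_vertexChain, sub_self]

variable [IsStrictTotalOrder V r]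

open Classical in
-- A Mayer–Vietoris argument. Split the cycle as $f_1+f_2$, with $f_2$ carried by the sets lying in
-- $F$ only. Then $\partial f_2=-\partial f_1$ lives on $F\cap G$, a simplex, and bounds some $w$
-- there; now $f_1+w$ is a cycle away from $F$ and $f_2-w$ a cycle in $F$.
theorem CyclesBound.of_leaf (C : Finset (Finset V)) (F G : Finset V) (hF : F ∈ C) (hG : G ∈ C)
    (hGF : G ≠ F) (hleaf : ∀ H ∈ C, H ≠ F → F ∩ H ⊆ G) {j : ℕ}
    (h : CyclesBound M r (fun s => ∃ H ∈ C.erase F, s ⊆ H) (j + 2)) :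
    CyclesBound M r (fun s => ∃ H ∈ C, s ⊆ H) (j + 2) := by
  intro f hf hd
  set Q : Finset V → Prop := fun s => ∃ H ∈ C.erase F, s ⊆ H
  have hQ : ∀ s t, s ⊆ t → Q t → Q s := fun s t hst ⟨H, hH, ht⟩ => ⟨H, hH, hst.trans ht⟩
  set f₁ : Finset V → M := fun s => if Q s then f s else 0
  set f₂ : Finset V → M := fun s => if Q s then 0 else f s
  have hf12 : f₁ + f₂ = f := by
    funext s
    simp only [f₁, f₂, Pi.add_apply]
    split_ifs <;> simp
  have hf₁ : ∀ s, f₁ s ≠ 0 → Q s ∧ s.card = j + 2 := by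
    intro s hs
    simp only [f₁] at hs
    split_ifs at hs with hq
    · exact ⟨hq, (hf s hs).2⟩
    · exact absurd rfl hs
  have hf₂ : ∀ s, f₂ s ≠ 0 → s ⊆ F ∧ s.card = j + 2 := by
    intro s hs
    simp only [f₂] at hs
    split_ifs at hs with hq
    · exact absurd rfl hs
    · obtain ⟨⟨H, hH, hsH⟩, hc⟩ := hf s hs
      by_cases hHF : H = F
      · exact ⟨hHF ▸ hsH, hc⟩
      · exact absurd ⟨H, Finset.mem_erase.mpr ⟨hHF, hH⟩, hsH⟩ hq
  have hsum : bdry r f₁ + bdry r f₂ = 0 := by rw [← bdry_add, hf12, hd]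
  have hsupp : ∀ s, bdry r f₂ s ≠ 0 → s ⊆ F ∩ G ∧ s.card = j + 1 := by
    intro s hs
    obtain ⟨hsF, hc⟩ := bdry_support (P := (· ⊆ F)) r (fun _ _ => Finset.Subset.trans) hf₂ s hs
    have hs1 : bdry r f₁ s ≠ 0 := by
      intro h0
      have := congrFun hsum s
      rw [Pi.add_apply, h0, zero_add] at this
      exact hs this
    obtain ⟨⟨H, hH, hsH⟩, -⟩ := bdry_support r hQ hf₁ s hs1
    rw [Finset.mem_erase] at hH
    exact ⟨Finset.subset_inter hsF
      ((Finset.subset_inter hsF hsH).trans (hleaf H hH.2 hH.1)), hc⟩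
  -- $F\cap G$ may be empty, which is harmless because $\partial f_2$ lives on sets of size
  -- $j+1\ge1$; this is why the statement starts at size 2.
  obtain ⟨w, hw, hwd⟩ := cyclesBound_simplex r (F ∩ G) (j + 1) (Or.inr (by omega))
    (bdry r f₂) hsupp (bdry_bdry r f₂)
  obtain ⟨g₁, hg₁, hgd₁⟩ := h (f₁ + w) (fun s hs => by
      by_cases h0 : f₁ s = 0
      · have hw0 : w s ≠ 0 := fun hw0 => hs (by simp [h0, hw0])
        exact ⟨⟨G, Finset.mem_erase.mpr ⟨hGF, hG⟩,
          (hw s hw0).1.trans Finset.inter_subset_right⟩, (hw s hw0).2⟩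
      · exact hf₁ s h0) (by rw [bdry_add, hwd, hsum])
  obtain ⟨g₂, hg₂, hgd₂⟩ := cyclesBound_simplex r F (j + 2) (Or.inr (by omega)) (f₂ - w)
    (fun s hs => by
      by_cases h0 : f₂ s = 0
      · have hw0 : w s ≠ 0 := fun hw0 => hs (by simp [h0, hw0])
        exact ⟨(hw s hw0).1.trans Finset.inter_subset_left, (hw s hw0).2⟩
      · exact hf₂ s h0) (by rw [bdry_sub, hwd, sub_self])
  refine ⟨g₁ + g₂, fun s hs => ?_, ?_⟩
  · by_cases h0 : g₁ s = 0
    · have h2 : g₂ s ≠ 0 := fun h2 => hs (by simp [h0, h2])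
      exact ⟨⟨F, hF, (hg₂ s h2).1⟩, (hg₂ s h2).2⟩
    · obtain ⟨⟨H, hH, hsH⟩, hc⟩ := hg₁ s h0
      exact ⟨⟨H, Finset.mem_of_mem_erase hH, hsH⟩, hc⟩
  · rw [bdry_add, hgd₁, hgd₂, ← hf12]
    abel

open Classical in
theorem cyclesBound_of_leaves (j : ℕ) (C : Finset (Finset V))
    (hC : ∀ D ⊆ C, D.Nonempty → ∃ F ∈ D, D = {F} ∨
      ∃ G ∈ D, G ≠ F ∧ ∀ H ∈ D, H ≠ F → F ∩ H ⊆ G) :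
    CyclesBound M r (fun s => ∃ H ∈ C, s ⊆ H) (j + 2) := by
  induction hn : C.card generalizing C with
  | zero =>
    intro f hf _
    rw [Finset.card_eq_zero.mp hn] at hf
    refine ⟨0, by simp, ?_⟩
    rw [bdry_zero]
    funext s
    by_contra hs
    simpa using (hf s (Ne.symm hs)).1
  | succ n ih =>
    obtain ⟨F, hF, rfl | ⟨G, hG, hGF, hleaf⟩⟩ := hC C subset_rfl (Finset.card_pos.mp (by omega))
    · simpa using cyclesBound_simplex (M := M) r F (j + 2) (Or.inr (by omega))
    · refine CyclesBound.of_leaf r C F G hF hG hGF hleaf (ih _ (fun D hD => ?_) ?_)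
      · exact hC D (hD.trans (Finset.erase_subset F C))
      · rw [Finset.card_erase_of_mem hF, hn, Nat.add_sub_cancel]

open Classical in
-- The boundaries of the edges of a path telescope.
theorem vertexChain_sub_mem_range_of_reachable (Δ : AbstractSimplicialComplex V) {u v : V}
    (h : (oneSkeleton Δ).Reachable u v) (a : M) :
    ∃ g : Finset V → M, (∀ s, g s ≠ 0 → (s ∈ Δ.faces ∨ s = ∅) ∧ s.card = 2) ∧
      bdry r g = vertexChain u a - vertexChain v a := by
  obtain ⟨p⟩ := h
  induction p with
  | nil => exact ⟨0, by simp, by rw [bdry_zero, sub_self]⟩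
  | @cons x y z hxy _ ih =>
    obtain ⟨g, hg, hgd⟩ := ih
    have hface : ({x, y} : Finset V) ∈ Δ.faces := by
      rw [oneSkeleton, SimpleGraph.fromRel_adj] at hxy
      rcases hxy.2 with h | h
      · exact h
      · rwa [Finset.pair_comm]
    obtain ⟨g', hg', hgd'⟩ := cyclesBound_simplex r ({x, y} : Finset V) 1 (Or.inr le_rfl)
      (vertexChain x a - vertexChain y a) (fun s hs => by
        obtain ⟨rfl | rfl, hc⟩ := vertexChain_sub_support x y a s hs <;> simp)
      (bdry_vertexChain_sub r x y a)
    refine ⟨g' + g, fun s hs => ?_, by rw [bdry_add, hgd, hgd', sub_add_sub_cancel]⟩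
    by_cases h0 : g s = 0
    · have h1 : g' s ≠ 0 := fun h1 => hs (by simp [h0, h1])
      refine ⟨Or.inl ((Δ.isRelLowerSet_faces hface).2 (hg' s h1).1 ?_), (hg' s h1).2⟩
      exact Finset.card_pos.mp (by rw [(hg' s h1).2]; omega)
    · exact hg s h0

/-- The coefficients of a cycle sum to zero, so it equals $\sum_v f(\{v\})\,(v-v_0)$, and each
difference bounds a path. -/
theorem cyclesBound_one_of_connected (Δ : AbstractSimplicialComplex V)
    (h : (oneSkeleton Δ).Connected) :
    CyclesBound M r (fun s => s ∈ Δ.faces ∨ s = ∅) 1 := by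
  classical
  intro f hf hd
  obtain ⟨v₀⟩ := h.nonempty
  choose g hg hgd using fun v => vertexChain_sub_mem_range_of_reachable r Δ
    (h.preconnected v v₀) (f {v})
  have hzero : ∑ v, f {v} = 0 := by
    have := congrFun hd ∅
    rw [bdry, Finset.compl_empty] at this
    simpa [sgn] using this
  refine ⟨∑ v, g v, fun s hs => ?_, ?_⟩
  · rw [Finset.sum_apply] at hs
    obtain ⟨v, -, hv⟩ := Finset.exists_ne_zero_of_sum_ne_zero hs
    exact hg v s hv
  · rw [bdry_sum]
    simp only [hgd]
    rw [Finset.sum_sub_distrib]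
    have h0 : ∑ v, vertexChain v₀ (f {v}) = 0 := by
      funext s
      rw [Finset.sum_apply, Pi.zero_apply]
      by_cases hs : s = {v₀}
      · simpa [vertexChain, hs] using hzero
      · simp [vertexChain, hs]
    rw [h0, sub_zero]
    funext s
    rw [Finset.sum_apply]
    simp only [vertexChain]
    by_cases hs : s.card = 1
    · obtain ⟨v, rfl⟩ := Finset.card_eq_one.mp hs
      simp
    · rw [not_imp_comm.mp (hf s) (fun h => hs h.2)]
      refine Finset.sum_eq_zero fun v _ => if_neg ?_
      rintro rfl
      exact hs (Finset.card_singleton v)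

theorem cyclesBound_zero_of_nonempty (Δ : AbstractSimplicialComplex V) (v : V)
    (hv : {v} ∈ Δ.faces) : CyclesBound M r (fun s => s ∈ Δ.faces ∨ s = ∅) 0 := by
  intro f hf hd
  obtain ⟨g, hg, hgf⟩ := cyclesBound_simplex r {v} 0 (Or.inl (Finset.singleton_nonempty v)) f
    (fun s hs => ⟨by simp [Finset.card_eq_zero.mp (hf s hs).2], (hf s hs).2⟩) hd
  refine ⟨g, fun s hs => ⟨?_, (hg s hs).2⟩, hgf⟩
  rcases Finset.subset_singleton_iff.mp (hg s hs).1 with h | h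
  · exact Or.inr h
  · exact Or.inl (h ▸ hv)

end Tree

lemma exists_isFacet {W : Type*} [Finite W] {K : PreAbstractSimplicialComplex W} (s : Face K) :
    ∃ F : Face K, IsFacet F ∧ s.1 ⊆ F.1 := by
  obtain ⟨F, hF, hmax⟩ := Finite.exists_le_maximal (p := fun _ : Face K => True) (a := s) trivial
  exact ⟨F, fun G hG => le_antisymm (hmax.2 trivial hG) hG, hF⟩

theorem isAcyclic_of_isTree {V : Type*} [Finite V] (R : Type*) [CommRing R]
    (Δ : AbstractSimplicialComplex V) (hΔ : IsTree Δ) :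
    IsAcyclic R Δ.toPreAbstractSimplicialComplex := by
  classical
  have := Fintype.ofFinite V
  obtain ⟨hconn, hleaf⟩ := hΔ
  rw [isAcyclic_iff]
  intro r hr j
  match j with
  | 0 =>
    obtain ⟨v⟩ := hconn.nonempty
    exact cyclesBound_zero_of_nonempty r Δ v (Δ.singleton_mem v)
  | 1 => exact cyclesBound_one_of_connected r Δ hconn
  | j + 2 =>
    have hiff : ∀ s : Finset V, (s ∈ Δ.faces ∨ s = ∅) ↔
        ∃ H ∈ (Finset.univ.filter fun F : Face Δ.toPreAbstractSimplicialComplex =>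
          IsFacet F).image Subtype.val, s ⊆ H := by
      intro s
      constructor
      · intro hs
        obtain ⟨F, hF, hsF⟩ := exists_isFacet (⟨s, hs⟩ : Face Δ.toPreAbstractSimplicialComplex)
        exact ⟨F.1, by simpa using ⟨F.2, hF⟩, hsF⟩
      · rintro ⟨H, hH, hsH⟩
        obtain ⟨F, -, rfl⟩ := Finset.mem_image.mp hH
        rcases s.eq_empty_or_nonempty with rfl | hne
        · exact Or.inr rfl
        · rcases F.2 with hF | hF
          · exact Or.inl ((Δ.isRelLowerSet_faces hF).2 hsH hne)
          · rw [hF] at hsH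
            exact Or.inr (Finset.subset_empty.mp hsH)
    simp only [hiff]
    refine cyclesBound_of_leaves r j _ fun D hD hDne => ?_
    have hD' : ∀ H ∈ D, ∃ F : Face Δ.toPreAbstractSimplicialComplex, IsFacet F ∧ F.1 = H := by
      intro H hH
      obtain ⟨F, hF, rfl⟩ := Finset.mem_image.mp (hD hH)
      exact ⟨F, (Finset.mem_filter.mp hF).2, rfl⟩
    obtain ⟨F, hF, h⟩ := hleaf {F | F.1 ∈ D}
      (by
        obtain ⟨H, hH⟩ := hDne
        obtain ⟨F, -, rfl⟩ := hD' H hH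
        exact ⟨F, hH⟩)
      (by
        intro F hF
        obtain ⟨F', hF', h⟩ := hD' F.1 hF
        rwa [← Subtype.ext h])
    refine ⟨F.1, hF, ?_⟩
    rcases h with h | ⟨G, hG, hGF, hH⟩
    · left
      ext H
      rw [Finset.mem_singleton]
      constructor
      · intro hH
        obtain ⟨F', -, rfl⟩ := hD' H hH
        have : F' ∈ ({F} : Set (Face Δ.toPreAbstractSimplicialComplex)) := h ▸ hH
        rw [Set.mem_singleton_iff.mp this]
      · rintro rfl
        exact hF
    · refine Or.inr ⟨G.1, hG, fun h => hGF (Subtype.ext h), fun H hHD hHF => ?_⟩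
      obtain ⟨F', -, rfl⟩ := hD' H hHD
      convert hH F' hHD (fun h => hHF (by rw [h]))

/-! ### The generators -/

section Generators

variable {V : Type*} {Δ : AbstractSimplicialComplex V}

/-- The faces whose variables occur in the generators: the facets, and the subsets of the facets
with one vertex less. -/
def IsFacetOrRidge (τ : Var Δ) : Prop :=
  IsFacet τ ∨ ∃ F : Var Δ, IsFacet F ∧ τ.1 ⊆ F.1 ∧ τ.1.card + 1 = F.1.card

lemma isFacetOrRidge_erase {F : Var Δ} (hF : IsFacet F) {v : V} (hv : v ∈ F.1) :
    IsFacetOrRidge (F.erase v) := by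
  classical
  refine Or.inr ⟨F, hF, Finset.erase_subset _ _, ?_⟩
  exact Finset.card_erase_add_one hv

lemma face_of_subset {s t : Finset V} (ht : t ∈ Δ.faces ∨ t = ∅) (hst : s ⊆ t) :
    s ∈ Δ.faces ∨ s = ∅ := by
  rcases s.eq_empty_or_nonempty with rfl | hne
  · exact Or.inr rfl
  · rcases ht with ht | rfl
    · exact Or.inl ((Δ.isRelLowerSet_faces ht).2 hst hne)
    · exact Or.inr (Finset.subset_empty.mp hst)

variable [Fintype V]

/-- Take a facet containing $s$ and, if it contains $v$, remove $v$. -/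
lemma exists_isFacetOrRidge {s : Finset V} (hs : s ∈ Δ.faces ∨ s = ∅) {v : V} (hv : v ∉ s) :
    ∃ τ : Var Δ, IsFacetOrRidge τ ∧ s ⊆ τ.1 ∧ v ∉ τ.1 := by
  classical
  obtain ⟨F, hF, hsF⟩ := exists_isFacet (⟨s, hs⟩ : Var Δ)
  by_cases hvF : v ∈ F.1
  · refine ⟨F.erase v, isFacetOrRidge_erase hF hvF, fun x hx => ?_, ?_⟩
    · exact Finset.mem_erase.mpr ⟨fun h => hv (h ▸ hx), hsF hx⟩
    · exact Finset.notMem_erase v F.1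
  · exact ⟨F, Or.inl hF, hsF, hvF⟩

open Classical in
-- Let $\tau$ be a facet $F$ minus a vertex, with $v\notin\tau$. If $v\in F$ then
-- $\tau=F\setminus\{v\}$ and the first product supplies $x_\tau$; otherwise the second one does.
lemma rawGenerator_ne_zero_iff (v : V) (τ : Var Δ) :
    rawGenerator Δ v τ ≠ 0 ↔ IsFacetOrRidge τ ∧ v ∉ τ.1 := by
  have h1 : rawGenerator Δ v τ ≠ 0 ↔
      (∃ G : Var Δ, (IsFacet G ∧ v ∈ G.1) ∧ G.erase v = τ) ∨
      ∃ F : Var Δ, (IsFacet F ∧ v ∉ F.1) ∧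
        (F = τ ∨ (τ.1 ⊆ F.1 ∧ τ.1.card + 1 = F.1.card)) := by
    have h2 : ∀ a b : Var Δ, Finsupp.single a 1 b ≠ 0 ↔ a = b := fun a b => by
      rw [Finsupp.single_apply]; simp
    have h3 : ∀ a b : ℕ, a + b ≠ 0 ↔ a ≠ 0 ∨ b ≠ 0 := by omega
    have h4 : ∀ (A : Finset (Var Δ)) (f : Var Δ → Var Δ →₀ ℕ),
        (∑ G ∈ A, f G) τ ≠ 0 ↔ ∃ G ∈ A, f G τ ≠ 0 := fun A f => by
      rw [Finsupp.finsetSum_apply, ne_eq, Finset.sum_eq_zero_iff]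
      push Not
      rfl
    rw [rawGenerator, Finsupp.add_apply, h3, h4, h4]
    simp only [Finsupp.add_apply, h3, h4, h2, Finset.mem_filter, Finset.mem_univ, true_and,
      exists_eq_right]
  rw [h1]
  constructor
  · rintro (⟨G, ⟨hG, hv⟩, rfl⟩ | ⟨F, ⟨hF, hv⟩, rfl | ⟨hτ, hc⟩⟩)
    · exact ⟨isFacetOrRidge_erase hG hv, Finset.notMem_erase v G.1⟩
    · exact ⟨Or.inl hF, hv⟩
    · exact ⟨Or.inr ⟨F, hF, hτ, hc⟩, fun h => hv (hτ h)⟩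
  · rintro ⟨hτ | ⟨F, hF, hτ, hc⟩, hv⟩
    · exact Or.inr ⟨τ, ⟨hτ, hv⟩, Or.inl rfl⟩
    · by_cases hvF : v ∈ F.1
      · refine Or.inl ⟨F, ⟨hF, hvF⟩, Subtype.ext (Finset.eq_of_subset_of_card_le ?_ ?_).symm⟩
        · exact fun x hx => Finset.mem_erase.mpr ⟨fun h => hv (h ▸ hx), hτ hx⟩
        · have : (F.1.erase v).card + 1 = F.1.card := Finset.card_erase_add_one hvF
          change (F.1.erase v).card ≤ _
          omega
      · exact Or.inr ⟨F, ⟨hF, hvF⟩, Or.inr ⟨hτ, hc⟩⟩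

open Classical in
lemma generator_apply (v : V) (τ : Var Δ) :
    generator Δ v τ = if IsFacetOrRidge τ ∧ v ∉ τ.1 then 1 else 0 := by
  rw [generator, Finsupp.mapRange_apply]
  have := rawGenerator_ne_zero_iff v τ
  split_ifs with h
  · have := this.mpr h
    omega
  · have := not_imp_comm.mp this.mp h
    omega

lemma lcmLabel_generator_le_iff (s : Finset V) (b : Var Δ →₀ ℕ) :
    lcmLabel (generator Δ) s ≤ b ↔ ∀ τ, IsFacetOrRidge τ → b τ = 0 → s ⊆ τ.1 := by
  rw [lcmLabel, Finset.sup_le_iff]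
  constructor
  · intro h τ hτ hb v hv
    by_contra hvτ
    have := h v hv τ
    rw [generator_apply, if_pos ⟨hτ, hvτ⟩] at this
    omega
  · intro h v hv τ
    rw [generator_apply]
    split_ifs with hτ
    · by_contra hb
      exact hτ.2 (h τ hτ.1 (by omega) hv)
    · exact Nat.zero_le _

/-- The variable $x_\tau$ is absent from $\operatorname{lcm}(t)$ exactly when $t\subseteq\tau$. -/
lemma lcmLabel_generator_le_lcmLabel_iff (s t : Finset V) :
    lcmLabel (generator Δ) s ≤ lcmLabel (generator Δ) t ↔
      ∀ τ : Var Δ, IsFacetOrRidge τ → t ⊆ τ.1 → s ⊆ τ.1 := by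
  rw [lcmLabel_generator_le_iff]
  refine forall₂_congr fun τ hτ => imp_congr_left ?_
  constructor
  · intro h
    exact (lcmLabel_generator_le_iff t _).mp le_rfl τ hτ h
  · intro h
    have h0 : ∀ v ∈ t, generator Δ v τ = 0 := fun v hv => by
      rw [generator_apply, if_neg fun h' => h'.2 (h hv)]
    have h1 : lcmLabel (generator Δ) t τ = t.sup fun v => generator Δ v τ := by
      rw [lcmLabel]
      exact Finset.apply_sup_eq_sup_comp (fun e : Var Δ →₀ ℕ => e τ)
        (fun x y => Finsupp.sup_apply x y τ) rfl
    rw [h1]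
    exact Nat.le_zero.mp (Finset.sup_le fun v hv => (h0 v hv).le)

lemma subset_of_lcmLabel_generator_le {s t : Finset V} (ht : t ∈ Δ.faces ∨ t = ∅)
    (h : lcmLabel (generator Δ) s ≤ lcmLabel (generator Δ) t) : s ⊆ t := by
  intro v hv
  by_contra hvt
  obtain ⟨τ, hτ, htτ, hvτ⟩ := exists_isFacetOrRidge ht hvt
  exact hvτ ((lcmLabel_generator_le_lcmLabel_iff s t).mp h τ hτ htτ hv)

lemma eq_of_generator_le {v w : V} (h : generator Δ v ≤ generator Δ w) : v = w := by
  have := subset_of_lcmLabel_generator_le (s := {v}) (t := {w}) (Or.inl (Δ.singleton_mem w))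
    (by simpa [lcmLabel] using h)
  simpa using this

lemma mem_faces_iff_lcmLabel_unique (hΔ : ¬IsBoundaryOfSimplex Δ) (s : Finset V) :
    (s ∈ Δ.faces ∨ s = ∅) ↔
      ∀ t, lcmLabel (generator Δ) t = lcmLabel (generator Δ) s → t = s := by
  constructor
  · intro hs t ht
    have hts := subset_of_lcmLabel_generator_le hs ht.le
    exact hts.antisymm (subset_of_lcmLabel_generator_le (face_of_subset hs hts) ht.ge)
  · intro h
    by_contra hs
    -- No test face contains $s$ or $t$, so the divisibility conditions hold vacuously in both
    -- directions.
    have huniq : ∀ t : Finset V, ¬(t ∈ Δ.faces ∨ t = ∅) → t = s := by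
      intro t ht
      refine h t (le_antisymm ?_ ?_)
      · exact (lcmLabel_generator_le_lcmLabel_iff _ _).mpr
          fun τ _ hτ => absurd (face_of_subset τ.2 hτ) hs
      · exact (lcmLabel_generator_le_lcmLabel_iff _ _).mpr
          fun τ _ hτ => absurd (face_of_subset τ.2 hτ) ht
    have huniv : ¬((Finset.univ : Finset V) ∈ Δ.faces ∨ (Finset.univ : Finset V) = ∅) :=
      fun hu => hs (face_of_subset hu (Finset.subset_univ s))
    refine hΔ fun u => ⟨fun hu h' => huniv (h' ▸ hu), fun hu => ?_⟩
    by_contra hu'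
    exact hu ((huniq u hu').trans (huniq _ huniv).symm)

theorem cyclesBound_lcmLabel_le {M : Type*} [AddCommGroup M] (r : V → V → Prop)
    [IsStrictTotalOrder V r] (j : ℕ) (hj : 1 ≤ j)
    (h : CyclesBound M r (fun s => s ∈ Δ.faces ∨ s = ∅) j) (b : Var Δ →₀ ℕ) :
    CyclesBound M r
      (fun s => (s ∈ Δ.faces ∨ s = ∅) ∧ lcmLabel (generator Δ) s ≤ b) j := by
  classical
  by_cases hb : ∃ τ : Var Δ, IsFacetOrRidge τ ∧ b τ = 0
  · obtain ⟨τ₀, hτ₀, hb₀⟩ := hb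
    have hiff : ∀ s : Finset V, ((s ∈ Δ.faces ∨ s = ∅) ∧ lcmLabel (generator Δ) s ≤ b) ↔
        s ⊆ Finset.univ.filter fun v => ∀ τ : Var Δ, IsFacetOrRidge τ → b τ = 0 → v ∈ τ.1 := by
      intro s
      rw [lcmLabel_generator_le_iff]
      constructor
      · intro hs v hv
        exact Finset.mem_filter.mpr ⟨Finset.mem_univ v, fun τ hτ hbτ => hs.2 τ hτ hbτ hv⟩
      · intro hs
        have hs' : ∀ τ : Var Δ, IsFacetOrRidge τ → b τ = 0 → s ⊆ τ.1 :=
          fun τ hτ hbτ v hv => (Finset.mem_filter.mp (hs hv)).2 τ hτ hbτ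
        exact ⟨face_of_subset τ₀.2 (hs' τ₀ hτ₀ hb₀), hs'⟩
    simp only [hiff]
    -- The intersection of the test faces may be empty, hence the need for $1\le j$.
    exact cyclesBound_simplex r _ j (Or.inr hj)
  · have hiff : ∀ s : Finset V, ((s ∈ Δ.faces ∨ s = ∅) ∧ lcmLabel (generator Δ) s ≤ b) ↔
        (s ∈ Δ.faces ∨ s = ∅) := by
      intro s
      rw [lcmLabel_generator_le_iff]
      exact and_iff_left fun τ hτ hbτ => absurd ⟨τ, hτ, hbτ⟩ hb
    simpa only [hiff] using h

end Generators

/-! ### Minimal generators and the Scarf complex -/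

section MinGens

variable {V ι k : Type*} [Field k]

lemma monomial_mem_span_range_iff (m : V → ι →₀ ℕ) (e : ι →₀ ℕ) :
    monomial e (1 : k) ∈ Ideal.span (Set.range fun v => monomial (m v) (1 : k)) ↔
      ∃ v, m v ≤ e := by
  classical
  rw [show (Set.range fun v => monomial (m v) (1 : k)) =
    (fun s => monomial s (1 : k)) '' Set.range m by rw [← Set.range_comp]; rfl,
    mem_ideal_span_monomial_image]
  simp [support_monomial]

lemma minGens_span_range (m : V → ι →₀ ℕ) (hm : ∀ v w, m v ≤ m w → v = w) :
    minGens (Ideal.span (Set.range fun v => monomial (m v) (1 : k))) = Set.range m := by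
  ext e
  simp only [minGens, Set.mem_ofPred_eq, monomial_mem_span_range_iff]
  constructor
  · rintro ⟨⟨v, hv⟩, hmin⟩
    exact ⟨v, le_antisymm hv (hmin ⟨v, le_rfl⟩ hv)⟩
  · rintro ⟨v, rfl⟩
    refine ⟨⟨v, le_rfl⟩, ?_⟩
    rintro e ⟨w, hw⟩ he
    rwa [← hm w v (hw.trans he)]

lemma lcmLabel_map {W : Type*} (e : V ≃ W) {m : V → ι →₀ ℕ} {m' : W → ι →₀ ℕ}
    (h : ∀ v, m' (e v) = m v) (s : Finset V) :
    lcmLabel m' (s.map e.toEmbedding) = lcmLabel m s := by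
  rw [lcmLabel, Finset.sup_map]
  exact Finset.sup_congr rfl fun v _ => h v

lemma not_lcmLabel_le_of_mem_scarfComplex {I : Ideal (MvPolynomial ι k)}
    {s t : Finset (minGens I)} (hs : s ∈ (scarfComplex I).faces) (ht : t ⊂ s) :
    ¬lcmLabel (fun g : minGens I => g.1) s ≤ lcmLabel (fun g : minGens I => g.1) t :=
  fun h => ht.ne (hs.2 t (le_antisymm (Finset.sup_mono ht.subset) h))

end MinGens

theorem isScarfComplexOf_trimmedIdeal {V : Type*} [Fintype V] (k : Type*) [Field k]
    (Δ : AbstractSimplicialComplex V) (hΔ : ¬IsBoundaryOfSimplex Δ) :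
    IsScarfComplexOf Δ (generator Δ) (trimmedIdeal k Δ) := by
  have hgens : minGens (trimmedIdeal k Δ) = Set.range (generator Δ) :=
    minGens_span_range _ fun v w => eq_of_generator_le
  let e : V ≃ minGens (trimmedIdeal k Δ) :=
    (Equiv.ofInjective (generator Δ) fun v w h => eq_of_generator_le h.le).trans
      (Equiv.setCongr hgens.symm)
  have he : ∀ v, (e v : Var Δ →₀ ℕ) = generator Δ v := fun v => rfl
  refine ⟨e, he, fun s => ?_⟩
  have h1 : s ∈ Δ.faces ↔ s.Nonempty ∧ (s ∈ Δ.faces ∨ s = ∅) := by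
    constructor
    · exact fun h => ⟨(Δ.isRelLowerSet_faces h).1, Or.inl h⟩
    · rintro ⟨hne, h | h⟩
      · exact h
      · exact absurd h hne.ne_empty
  rw [h1, mem_faces_iff_lcmLabel_unique hΔ]
  change _ ↔ (s.map e.toEmbedding).Nonempty ∧ _
  rw [Finset.map_nonempty]
  refine and_congr_right fun _ => ?_
  constructor
  · intro h t ht
    have ht' : (t.map e.symm.toEmbedding).map e.toEmbedding = t := by
      ext x; simp
    rw [← ht', lcmLabel_map e he, lcmLabel_map e he] at ht
    rw [← h _ ht, ht']
  · intro h t ht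
    refine Finset.map_injective e.toEmbedding (h _ ?_)
    rw [lcmLabel_map e he, lcmLabel_map e he, ht]

/-- If the subcomplexes of `Δ` cut out by the labels are acyclic, both `Δ` and the Scarf complex to
which it is identified by its labelling resolve the ideal. -/
theorem IsScarfComplexOf.minimallyResolves {V ι k : Type*} [Fintype V] [Field k]
    {Δ : AbstractSimplicialComplex V} {m : V → ι →₀ ℕ} {I : Ideal (MvPolynomial ι k)}
    (h : IsScarfComplexOf Δ m I)
    (hI : I = Ideal.span (Set.range fun v => monomial (m v) (1 : k)))
    (hc : ∀ r : V → V → Prop, IsStrictTotalOrder V r → ∀ (b : ι →₀ ℕ) (j : ℕ), 1 ≤ j →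
      CyclesBound k r (fun s => (s ∈ Δ.faces ∨ s = ∅) ∧ lcmLabel m s ≤ b) j) :
    IsScarfIdeal I ∧ MinimallyResolves Δ.toPreAbstractSimplicialComplex m I := by
  obtain ⟨e, he, hface⟩ := h
  have hlcm : ∀ s : Finset V, lcmLabel (fun g : minGens I => g.1) (s.map e.toEmbedding) =
      lcmLabel m s := lcmLabel_map e he
  constructor
  · have : Fintype (minGens I) := Fintype.ofEquiv V e
    have hspan : I = Ideal.span (Set.range fun g : minGens I => monomial g.1 (1 : k)) := by
      have : (fun v => monomial (m v) (1 : k)) =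
          (fun g : minGens I => monomial g.1 (1 : k)) ∘ e := by
        funext v
        simp [he]
      conv_lhs => rw [hI, this, e.surjective.range_comp]
    have key := minimallyResolves_of_cyclesBound (k := k) (K := scarfComplex I)
      (fun g : minGens I => g.1)
      (fun g => by
        have := (hface {e.symm g}).mp (Δ.singleton_mem _)
        simpa using this)
      (fun s hs t => not_lcmLabel_le_of_mem_scarfComplex hs)
      (fun r hr b j hj => by
        refine CyclesBound.map_equiv e ?_
        simp only [hlcm, ← hface, Finset.map_eq_empty]
        exact hc _ (RelEmbedding.preimage e.toEmbedding r).isStrictTotalOrder b j hj)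
    rwa [← hspan] at key
  · rw [hI]
    -- Strict growth of the labels on $\Delta$ is inherited from uniqueness of lcms in the Scarf
    -- complex.
    refine minimallyResolves_of_cyclesBound m Δ.singleton_mem (fun s hs t ht hle => ?_) hc
    refine not_lcmLabel_le_of_mem_scarfComplex ((hface s).mp hs) (Finset.map_ssubset_map.mpr ht) ?_
    rwa [hlcm, hlcm]

end Scarf

theorem mainTheorem3 {V : Type*} [Fintype V] (k : Type*) [Field k]
    (Δ : AbstractSimplicialComplex V) (hΔ : ¬ Scarf.IsBoundaryOfSimplex Δ) :
    Scarf.IsScarfComplexOf Δ (Scarf.generator Δ) (Scarf.trimmedIdeal k Δ) ∧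
    (Scarf.IsAcyclic k Δ.toPreAbstractSimplicialComplex ∨ Scarf.IsTree Δ →
      Scarf.IsScarfIdeal (Scarf.trimmedIdeal k Δ) ∧
      Scarf.MinimallyResolves Δ.toPreAbstractSimplicialComplex (Scarf.generator Δ)
        (Scarf.trimmedIdeal k Δ)) := by
  have hscarf := Scarf.isScarfComplexOf_trimmedIdeal k Δ hΔ
  refine ⟨hscarf, fun h => ?_⟩
  have hacyclic : Scarf.IsAcyclic k Δ.toPreAbstractSimplicialComplex :=
    h.elim id (Scarf.isAcyclic_of_isTree k Δ)
  exact Scarf.IsScarfComplexOf.minimallyResolves hscarf rfl fun r hr b j hj =>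
    Scarf.cyclesBound_lcmLabel_le r j hj (Scarf.isAcyclic_iff.mp hacyclic r hr j) b
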